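/- Let $M$ be a paracompact Hausdorff smooth manifold and let $(L,Y)$ be a bundle gerbe over $M$: that is, $\pi\colon Y\to M$ is a smooth locally split map of (possibly infinite-dimensional, Banach) manifolds (every point of $M$ has an open neighbourhood on which $\pi$ has a smooth section), and $L\to Y^{[2]}=Y\times_\pi Y$ is a smooth hermitian line bundle with a smooth, associative hermitian isomorphism $L_{(y_1,y_2)}\otimes L_{(y_2,y_3)}\to L_{(y_1,y_3)}$ for all $y_1,y_2,y_3$ in a common fibre of $\pi$. Its Dixmier-Douady class $d(L)\in H^3(M,\mathbb Z)$ is defined as follows. Take an open cover $\{U_\alpha\}$ of $M$ with smooth sections $s_\alpha\colon U_\alpha\to Y$ of $\pi$, smooth unit sections $\sigma_{\alpha\beta}$ of $(s_\alpha,s_\beta)^{-1}L$ over $U_\alpha\cap U_\beta$, and functions $f_{\alpha\beta\gamma}\colon U_\alpha\cap U_\beta\cap U_\gamma\to\mathbb R$ with $\sigma_{\alpha\beta}\sigma_{\beta\gamma}=e^{2\pi i f_{\alpha\beta\gamma}}\sigma_{\alpha\gamma}$; then $d(L)$ is the class of the integral Čech cocycle $\delta f$. Such choices exist, and the class does not depend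 on them. Suppose that $(L,Y)$ has a bundle gerbe module of finite rank $r$: a smooth hermitian vector bundle $E\to Y$ of rank $r$ with a smooth hermitian isomorphism $L_{(y_1,y_2)}\otimes E_{y_2}\to E_{y_1}$, for all $(y_1,y_2)\in Y^{[2]}$, that is compatible with the product of $L$ (the two resulting maps $L_{(y_1,y_2)}\otimes L_{(y_2,y_3)}\otimes E_{y_3}\to E_{y_1}$ agree). Then $r\,d(L)=0$ in $H^3(M,\mathbb Z)$. -/

import Mathlib

open scoped Manifold ContDiff TensorProduct Topology

/-! ### Čech cohomology with integer coefficients -/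

/-- An open cover of `M` indexed by the points of `M`, the point `x` lying in the member with
index `x`. Every open cover is refined by such a cover, and these covers are directed under
memberwise inclusion; so they compute Čech cohomology as a direct limit over open covers. -/
structure PointedCover (M : Type*) [TopologicalSpace M] where
  U : M → Set M
  isOpen_U : ∀ x, IsOpen (U x)
  mem_U : ∀ x, x ∈ U x

namespace PointedCover

variable {M : Type*} [TopologicalSpace M]

/-- The intersection `U_{x₀} ∩ ⋯ ∩ U_{xₙ}`. -/
def inter (𝒰 : PointedCover M) {n : ℕ} (x : Fin (n + 1) → M) : Set M :=
  ⋂ i, 𝒰.U (x i)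

/-- The cover with members `U_x ∩ V_x`. -/
def inf (𝒰 𝒱 : PointedCover M) : PointedCover M where
  U x := 𝒰.U x ∩ 𝒱.U x
  isOpen_U x := (𝒰.isOpen_U x).inter (𝒱.isOpen_U x)
  mem_U x := ⟨𝒰.mem_U x, 𝒱.mem_U x⟩

/-- The cover all of whose members are the whole space. -/
def top : PointedCover M where
  U _ := Set.univ
  isOpen_U _ := isOpen_univ
  mem_U _ := trivial

theorem inter_inf_left (𝒰 𝒱 : PointedCover M) {n : ℕ} (x : Fin (n + 1) → M) :
    (𝒰.inf 𝒱).inter x ⊆ 𝒰.inter x :=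
  Set.iInter_mono fun _ => Set.inter_subset_left

theorem inter_inf_right (𝒰 𝒱 : PointedCover M) {n : ℕ} (x : Fin (n + 1) → M) :
    (𝒰.inf 𝒱).inter x ⊆ 𝒱.inter x :=
  Set.iInter_mono fun _ => Set.inter_subset_right

theorem inter_subset_face (𝒰 : PointedCover M) {n : ℕ} (x : Fin (n + 2) → M) (i : Fin (n + 2)) :
    𝒰.inter x ⊆ 𝒰.inter (x ∘ i.succAbove) :=
  Set.subset_iInter fun j => Set.iInter_subset (fun k => 𝒰.U (x k)) (i.succAbove j)

end PointedCover

/-- The Čech differential `(δf)_{x₀…xₙ₊₁} = ∑ᵢ (-1)ⁱ f_{x₀…x̂ᵢ…xₙ₊₁}`, where `f x p` is the value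
at the point `p` of the component of `f` with multi-index `x`. -/
def cechDelta {M A : Type*} [AddCommGroup A] (n : ℕ) :
    ((Fin (n + 1) → M) → M → A) →+ ((Fin (n + 2) → M) → M → A) where
  toFun f x p := ∑ i : Fin (n + 2), (-1 : ℤ) ^ (i : ℕ) • f (x ∘ i.succAbove) p
  map_zero' := by
    funext x p
    simp
  map_add' f g := by
    funext x p
    simp [Finset.sum_add_distrib]

/-- Čech `n`-cochains with values in the constant sheaf `ℤ`: for some cover `𝒰`, the component with
multi-index `x` is a locally constant function on `𝒰.inter x`. The values of a cochain outside
`𝒰.inter x` carry no information: see `cechNull`. -/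
def cechCochains (M : Type*) [TopologicalSpace M] (n : ℕ) :
    AddSubgroup ((Fin (n + 1) → M) → M → ℤ) where
  carrier := {f | ∃ 𝒰 : PointedCover M, ∀ x, ContinuousOn (f x) (𝒰.inter x)}
  zero_mem' := ⟨PointedCover.top, fun _ => continuousOn_const⟩
  add_mem' := by
    rintro f g ⟨𝒰, hf⟩ ⟨𝒱, hg⟩
    exact ⟨𝒰.inf 𝒱, fun x => ((hf x).mono (𝒰.inter_inf_left 𝒱 x)).add
      ((hg x).mono (𝒰.inter_inf_right 𝒱 x))⟩
  neg_mem' := by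
    rintro f ⟨𝒰, hf⟩
    exact ⟨𝒰, fun x => (hf x).neg⟩

/-- Families that represent the zero cochain in the direct limit: they vanish on the intersections
of some cover. -/
def cechNull (M : Type*) [TopologicalSpace M] (n : ℕ) :
    AddSubgroup ((Fin (n + 1) → M) → M → ℤ) where
  carrier := {f | ∃ 𝒰 : PointedCover M, ∀ x, ∀ p ∈ 𝒰.inter x, f x p = 0}
  zero_mem' := ⟨PointedCover.top, fun _ _ _ => rfl⟩
  add_mem' := by
    rintro f g ⟨𝒰, hf⟩ ⟨𝒱, hg⟩
    refine ⟨𝒰.inf 𝒱, fun x p hp => ?_⟩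
    have h1 := hf x p (𝒰.inter_inf_left 𝒱 x hp)
    have h2 := hg x p (𝒰.inter_inf_right 𝒱 x hp)
    simp [h1, h2]
  neg_mem' := by
    rintro f ⟨𝒰, hf⟩
    exact ⟨𝒰, fun x p hp => by simp [hf x p hp]⟩

/-- Čech `n`-cocycles: cochains whose differential is zero in the direct limit. -/
def cechCocycles (M : Type*) [TopologicalSpace M] (n : ℕ) :
    AddSubgroup ((Fin (n + 1) → M) → M → ℤ) :=
  cechCochains M n ⊓ (cechNull M (n + 1)).comap (cechDelta n)

/-- Čech `n`-coboundaries: families that agree, in the direct limit, with the differential of an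
`(n-1)`-cochain. -/
def cechCoboundaries (M : Type*) [TopologicalSpace M] :
    (n : ℕ) → AddSubgroup ((Fin (n + 1) → M) → M → ℤ)
  | 0 => cechNull M 0
  | n + 1 => (cechCochains M n).map (cechDelta n) ⊔ cechNull M (n + 1)

/-- The cohomology group `Hⁿ(M, ℤ)`, as Čech cohomology: the `n`-th cohomology of the direct limit,
over the open covers of `M`, of the Čech complexes of the constant sheaf `ℤ`. -/
abbrev CechCohomology (M : Type*) [TopologicalSpace M] (n : ℕ) : Type _ :=
  cechCocycles M n ⧸ (cechCoboundaries M n).addSubgroupOf (cechCocycles M n)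

/-! ### Smooth functions and hermitian bundles on subspaces of manifolds

A fibre product `Y ×_M Y` over a locally split map need not be a submanifold of `Y × Y`; a function
on it is smooth if it extends locally to a smooth function on `Y × Y`. Below, `ι : B → N` is the
inclusion of a subspace `B` of a manifold `N` (or the identity map of `N`). -/

/-- `f` is smooth on `u ⊆ B`: near each point of `u` it is, on `u`, the restriction of a smooth
function defined on an open subset of `N`. -/
def SmoothAlong {EN HN N : Type*} [NormedAddCommGroup EN] [NormedSpace ℝ EN] [TopologicalSpace HN]
    (I : ModelWithCorners ℝ EN HN) [TopologicalSpace N] [ChartedSpace HN N]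
    {B : Type*} [TopologicalSpace B] (ι : B → N) (f : B → ℂ) (u : Set B) : Prop :=
  ∀ b ∈ u, ∃ (W : Set N) (g : N → ℂ), IsOpen W ∧ ι b ∈ W ∧ ContMDiffOn I 𝓘(ℝ, ℂ) ∞ g W ∧
    ∀ᶠ b' in 𝓝[u] b, f b' = g (ι b')

/-- An orthonormal frame, over the set `dom`, of a family of hermitian inner product spaces (the
bases over points outside `dom` are irrelevant). -/
structure LocalFrame {B : Type*} (V : B → Type*) [∀ b, NormedAddCommGroup (V b)]
    [∀ b, InnerProductSpace ℂ (V b)] (r : ℕ) where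
  dom : Set B
  basis : ∀ b, OrthonormalBasis (Fin r) ℂ (V b)

/-- A smooth hermitian vector bundle of rank `r` over `B`: a family of hermitian inner product
spaces with an atlas of local orthonormal frames whose transition functions are smooth. -/
structure HermitianBundle {EN HN N : Type*} [NormedAddCommGroup EN] [NormedSpace ℝ EN]
    [TopologicalSpace HN] (I : ModelWithCorners ℝ EN HN) [TopologicalSpace N] [ChartedSpace HN N]
    {B : Type*} [TopologicalSpace B] (ι : B → N) (r : ℕ) where
  fiber : B → Type*
  [normedFiber : ∀ b, NormedAddCommGroup (fiber b)]
  [innerFiber : ∀ b, InnerProductSpace ℂ (fiber b)]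
  atlas : Set (LocalFrame fiber r)
  isOpen_dom : ∀ e ∈ atlas, IsOpen e.dom
  exists_mem_dom : ∀ b, ∃ e ∈ atlas, b ∈ e.dom
  smooth_transition : ∀ e ∈ atlas, ∀ e' ∈ atlas, ∀ i j,
    SmoothAlong I ι (fun b => inner ℂ (e.basis b i) (e'.basis b j)) (e.dom ∩ e'.dom)

attribute [instance] HermitianBundle.normedFiber HermitianBundle.innerFiber

/-! ### Bundle gerbes and their modules -/

/-- The fibre product `Y^[2]`. -/
abbrev FibreProd₂ {Y M : Type*} (π : Y → M) : Type _ :=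
  {q : Y × Y // π q.1 = π q.2}

/-- The fibre product `Y^[3]`. -/
abbrev FibreProd₃ {Y M : Type*} (π : Y → M) : Type _ :=
  {q : Y × Y × Y // π q.1 = π q.2.1 ∧ π q.2.1 = π q.2.2}

section Gerbes

universe uE uH uF uK uM uY w w'

variable {EM : Type uE} {HM : Type uH} {EY : Type uF} {HY : Type uK}
  [NormedAddCommGroup EM] [NormedSpace ℝ EM] [TopologicalSpace HM]
  [NormedAddCommGroup EY] [NormedSpace ℝ EY] [TopologicalSpace HY]
  (IM : ModelWithCorners ℝ EM HM) (IY : ModelWithCorners ℝ EY HY)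
  (M : Type uM) (Y : Type uY)
  [TopologicalSpace M] [ChartedSpace HM M] [TopologicalSpace Y] [ChartedSpace HY Y]

/-- A (hermitian) bundle gerbe `(L, Y)` over `M`: a smooth locally split map `π : Y → M` and a
smooth hermitian line bundle `L → Y^[2]` with a smooth associative product
`L_{(y₁,y₂)} ⊗ L_{(y₂,y₃)} ≃ L_{(y₁,y₃)}` that is a hermitian isomorphism. -/
structure BundleGerbe where
  π : Y → M
  smooth_π : ContMDiff IY IM ∞ π
  locallySplit : ∀ x : M, ∃ (U : Set M) (s : M → Y), IsOpen U ∧ x ∈ U ∧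
    ContMDiffOn IM IY ∞ s U ∧ ∀ p ∈ U, π (s p) = p
  L : HermitianBundle.{uF, uK, uY, uY, w} (IY.prod IY) (Subtype.val : FibreProd₂ π → Y × Y) 1
  mul : ∀ (y₁ y₂ y₃ : Y) (h₁₂ : π y₁ = π y₂) (h₂₃ : π y₂ = π y₃),
    (L.fiber ⟨(y₁, y₂), h₁₂⟩ ⊗[ℂ] L.fiber ⟨(y₂, y₃), h₂₃⟩) ≃ₗᵢ[ℂ]
      L.fiber ⟨(y₁, y₃), h₁₂.trans h₂₃⟩
  smooth_mul : ∀ e ∈ L.atlas, ∀ e' ∈ L.atlas, ∀ e'' ∈ L.atlas,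
    SmoothAlong (IY.prod (IY.prod IY)) (Subtype.val : FibreProd₃ π → Y × Y × Y)
      (fun q => inner ℂ (e''.basis ⟨(q.1.1, q.1.2.2), q.2.1.trans q.2.2⟩ 0)
        (mul q.1.1 q.1.2.1 q.1.2.2 q.2.1 q.2.2
          (e.basis ⟨(q.1.1, q.1.2.1), q.2.1⟩ 0 ⊗ₜ[ℂ]
            e'.basis ⟨(q.1.2.1, q.1.2.2), q.2.2⟩ 0)))
      {q | (⟨(q.1.1, q.1.2.1), q.2.1⟩ : FibreProd₂ π) ∈ e.dom ∧
        (⟨(q.1.2.1, q.1.2.2), q.2.2⟩ : FibreProd₂ π) ∈ e'.dom ∧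
        (⟨(q.1.1, q.1.2.2), q.2.1.trans q.2.2⟩ : FibreProd₂ π) ∈ e''.dom}
  mul_assoc : ∀ (y₁ y₂ y₃ y₄ : Y) (h₁₂ : π y₁ = π y₂) (h₂₃ : π y₂ = π y₃) (h₃₄ : π y₃ = π y₄)
    (a : L.fiber ⟨(y₁, y₂), h₁₂⟩) (b : L.fiber ⟨(y₂, y₃), h₂₃⟩) (c : L.fiber ⟨(y₃, y₄), h₃₄⟩),
    mul y₁ y₃ y₄ (h₁₂.trans h₂₃) h₃₄ (mul y₁ y₂ y₃ h₁₂ h₂₃ (a ⊗ₜ b) ⊗ₜ c) =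
      mul y₁ y₂ y₄ h₁₂ (h₂₃.trans h₃₄) (a ⊗ₜ mul y₂ y₃ y₄ h₂₃ h₃₄ (b ⊗ₜ c))

variable {IM IY M Y}

namespace BundleGerbe

/-- A bundle gerbe module of rank `r`: a smooth hermitian vector bundle `E → Y` of rank `r` with a
smooth hermitian isomorphism `L_{(y₁,y₂)} ⊗ E_{y₂} ≃ E_{y₁}` compatible with the product of `L`. -/
structure Module (G : BundleGerbe IM IY M Y) (r : ℕ) where
  E : HermitianBundle.{uF, uK, uY, uY, w'} IY (id : Y → Y) r
  act : ∀ (y₁ y₂ : Y) (h : G.π y₁ = G.π y₂),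
    (G.L.fiber ⟨(y₁, y₂), h⟩ ⊗[ℂ] E.fiber y₂) ≃ₗᵢ[ℂ] E.fiber y₁
  smooth_act : ∀ l ∈ G.L.atlas, ∀ e ∈ E.atlas, ∀ e' ∈ E.atlas, ∀ i j,
    SmoothAlong (IY.prod IY) (Subtype.val : FibreProd₂ G.π → Y × Y)
      (fun q => inner ℂ (e.basis q.1.1 i)
        (act q.1.1 q.1.2 q.2 (l.basis q 0 ⊗ₜ[ℂ] e'.basis q.1.2 j)))
      {q | q ∈ l.dom ∧ q.1.1 ∈ e.dom ∧ q.1.2 ∈ e'.dom}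
  act_act : ∀ (y₁ y₂ y₃ : Y) (h₁₂ : G.π y₁ = G.π y₂) (h₂₃ : G.π y₂ = G.π y₃)
    (a : G.L.fiber ⟨(y₁, y₂), h₁₂⟩) (b : G.L.fiber ⟨(y₂, y₃), h₂₃⟩) (v : E.fiber y₃),
    act y₁ y₂ h₁₂ (a ⊗ₜ act y₂ y₃ h₂₃ (b ⊗ₜ v)) =
      act y₁ y₃ (h₁₂.trans h₂₃) (G.mul y₁ y₂ y₃ h₁₂ h₂₃ (a ⊗ₜ b) ⊗ₜ v)

/-- The choices made in the construction of the Dixmier-Douady class: an open cover `(U_x)` of `M`,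
smooth local sections `s_x : U_x → Y` of `π`, smooth unit sections `σ_{xy}` over `U_x ∩ U_y` of the
pull-back of `L` by `(s_x, s_y)`, and functions `f_{xyz}` on `U_x ∩ U_y ∩ U_z` with
`σ_{xy} σ_{yz} = exp(2πi f_{xyz}) σ_{xz}`. The functions `exp(2πi f_{xyz})` are smooth, so that the
continuous functions `f_{xyz}` are smooth too. -/
structure DixmierDouadyData (G : BundleGerbe IM IY M Y) where
  cover : PointedCover M
  s : M → M → Y
  smooth_s : ∀ x, ContMDiffOn IM IY ∞ (s x) (cover.U x)
  π_s : ∀ x, ∀ p ∈ cover.U x, G.π (s x p) = p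
  σ : ∀ (x y : M) (p : ↥(cover.U x ∩ cover.U y)),
    G.L.fiber ⟨(s x p, s y p), (π_s x p p.2.1).trans (π_s y p p.2.2).symm⟩
  norm_σ : ∀ x y p, ‖σ x y p‖ = 1
  smooth_σ : ∀ x y, ∀ e ∈ G.L.atlas,
    SmoothAlong IM (Subtype.val : ↥(cover.U x ∩ cover.U y) → M)
      (fun p => inner ℂ
        (e.basis ⟨(s x p, s y p), (π_s x p p.2.1).trans (π_s y p p.2.2).symm⟩ 0) (σ x y p))
      {p | (⟨(s x p, s y p), (π_s x p p.2.1).trans (π_s y p p.2.2).symm⟩ : FibreProd₂ G.π) ∈ e.dom}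
  f : (Fin 3 → M) → M → ℝ
  continuousOn_f : ∀ x, ContinuousOn (f x) (cover.inter x)
  mul_σ : ∀ (x y z p : M) (hx : p ∈ cover.U x) (hy : p ∈ cover.U y) (hz : p ∈ cover.U z),
    G.mul (s x p) (s y p) (s z p) ((π_s x p hx).trans (π_s y p hy).symm)
        ((π_s y p hy).trans (π_s z p hz).symm)
        (σ x y ⟨p, hx, hy⟩ ⊗ₜ σ y z ⟨p, hy, hz⟩) =
      Complex.exp (2 * Real.pi * Complex.I * f ![x, y, z] p) • σ x z ⟨p, hx, hz⟩

/-- `c` is the class of the integral Čech 3-cocycle `δf` obtained from some choice of data, that is,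
the image of the class of `exp(2πi f)` under the connecting homomorphism of
`0 → ℤ → ℝ → U(1) → 0`. -/
def IsDixmierDouadyClass (G : BundleGerbe IM IY M Y) (c : CechCohomology M 3) : Prop :=
  ∃ (D : G.DixmierDouadyData) (n : cechCocycles M 3),
    (∀ (x : Fin 4 → M), ∀ p ∈ D.cover.inter x, ((n.1 x p : ℤ) : ℝ) = cechDelta 2 D.f x p) ∧
    c = QuotientAddGroup.mk n

/-- The Dixmier-Douady class `d(L) ∈ H³(M, ℤ)`. -/
noncomputable def dixmierDouadyClass (G : BundleGerbe IM IY M Y) : CechCohomology M 3 :=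
  Classical.epsilon G.IsDixmierDouadyClass

end BundleGerbe

end Gerbes

/-! ### Čech cochains -/

section Cech

variable {M : Type*}

/-! The torsion statement comes from taking determinants. Choose local sections `s x`, unit sections
`σ x y` and logarithms `f` as in the definition of the class. In orthonormal frames of the module
pulled back by the `s x`, the action of `σ x y` is a unitary r × r matrix A_xy. Compatibility with
the gerbe product gives A_xy A_yz = exp(2πi f_xyz) A_xz, and determinants turn this into h_xy h_yz =
exp(2πi r f_xyz) h_xz with h = det A. So exp(2πi r f) is the differential of a U(1)-valued cochain,
and r δf must be an integral coboundary.

That last implication is `mem_cechCoboundaries_of_exp_eq`: on a finer cover h has real logarithms k,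
the cochain r f − δk is integer-valued, and its differential is r δf. The same lemma proves
independence of choices: for two sets of data, unit sections of `L` over (s_x, s'_x) provide an h
whose differential is exp(2πi (f − f')) (`mul_eq_of_intertwining`, `sub_mem_cechCoboundaries`).

Frames on double overlaps and logarithms on multiple overlaps exist only locally. Paracompactness
makes them available on whole intersections of a finer cover (`exists_pointedCover_refinement`).
Apart from constructing smooth data, only continuity is used, since integral Čech classes are
insensitive to the difference. -/

theorem vec_comp_succAbove_three {A : Type*} (f : (Fin 3 → M) → A) (x : Fin 4 → M) :
    f (x ∘ (0 : Fin 4).succAbove) = f ![x 1, x 2, x 3] ∧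
    f (x ∘ (1 : Fin 4).succAbove) = f ![x 0, x 2, x 3] ∧
    f (x ∘ (2 : Fin 4).succAbove) = f ![x 0, x 1, x 3] ∧
    f (x ∘ (3 : Fin 4).succAbove) = f ![x 0, x 1, x 2] := by
  refine ⟨?_, ?_, ?_, ?_⟩ <;> congr 1 <;> ext k <;> fin_cases k <;> rfl

theorem cechDelta_two_apply {A : Type*} [AddCommGroup A] (f : (Fin 3 → M) → M → A)
    (x : Fin 4 → M) (p : M) :
    cechDelta 2 f x p = f ![x 1, x 2, x 3] p - f ![x 0, x 2, x 3] p + f ![x 0, x 1, x 3] p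
      - f ![x 0, x 1, x 2] p := by
  obtain ⟨h0, h1, h2, h3⟩ := vec_comp_succAbove_three f x
  change ∑ i : Fin 4, (-1 : ℤ) ^ (i : ℕ) • f (x ∘ i.succAbove) p = _
  rw [Fin.sum_univ_four, h0, h1, h2, h3]
  simp [pow_succ]
  abel

theorem cechDelta_three_apply {A : Type*} [AddCommGroup A] (f : (Fin 4 → M) → M → A)
    (x : Fin 5 → M) (p : M) :
    cechDelta 3 f x p = f ![x 1, x 2, x 3, x 4] p - f ![x 0, x 2, x 3, x 4] p
      + f ![x 0, x 1, x 3, x 4] p - f ![x 0, x 1, x 2, x 4] p + f ![x 0, x 1, x 2, x 3] p := by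
  have h0 : x ∘ (0 : Fin 5).succAbove = ![x 1, x 2, x 3, x 4] := by
    ext k; fin_cases k <;> rfl
  have h1 : x ∘ (1 : Fin 5).succAbove = ![x 0, x 2, x 3, x 4] := by
    ext k; fin_cases k <;> rfl
  have h2 : x ∘ (2 : Fin 5).succAbove = ![x 0, x 1, x 3, x 4] := by
    ext k; fin_cases k <;> rfl
  have h3 : x ∘ (3 : Fin 5).succAbove = ![x 0, x 1, x 2, x 4] := by
    ext k; fin_cases k <;> rfl
  have h4 : x ∘ (4 : Fin 5).succAbove = ![x 0, x 1, x 2, x 3] := by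
    ext k; fin_cases k <;> rfl
  change ∑ i : Fin 5, (-1 : ℤ) ^ (i : ℕ) • f (x ∘ i.succAbove) p = _
  rw [Fin.sum_univ_five, h0, h1, h2, h3, h4]
  simp [pow_succ]
  abel

theorem cechDelta_cechDelta_two {A : Type*} [AddCommGroup A] (f : (Fin 3 → M) → M → A)
    (x : Fin 5 → M) (p : M) : cechDelta 3 (cechDelta 2 f) x p = 0 := by
  rw [cechDelta_three_apply]
  simp only [cechDelta_two_apply]
  simp
  abel

/-! ### Integral cocycles, fine refinements and logarithms -/

variable [TopologicalSpace M]

namespace PointedCover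

theorem mem_inter_three {𝒰 : PointedCover M} {x : Fin 3 → M} {p : M} :
    p ∈ 𝒰.inter x ↔ p ∈ 𝒰.U (x 0) ∧ p ∈ 𝒰.U (x 1) ∧ p ∈ 𝒰.U (x 2) := by
  simp [inter, Fin.forall_fin_succ]

theorem mem_inter_two {𝒰 : PointedCover M} {x : Fin 2 → M} {p : M} :
    p ∈ 𝒰.inter x ↔ p ∈ 𝒰.U (x 0) ∧ p ∈ 𝒰.U (x 1) := by
  simp [inter, Fin.forall_fin_succ]

theorem mem_inter_four {𝒰 : PointedCover M} {x : Fin 4 → M} {p : M} :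
    p ∈ 𝒰.inter x ↔ p ∈ 𝒰.U (x 0) ∧ p ∈ 𝒰.U (x 1) ∧ p ∈ 𝒰.U (x 2) ∧ p ∈ 𝒰.U (x 3) := by
  simp [inter, Fin.forall_fin_succ]

end PointedCover

/-- ℤ carries the topology induced from ℝ, so continuity can be checked after the coercion, where
rounding changes nothing on `S`. -/
theorem continuousOn_round_of_int {S : Set M} {g : M → ℝ} (hg : ContinuousOn g S)
    (hint : ∀ p ∈ S, ∃ n : ℤ, g p = n) : ContinuousOn (fun p => round (g p)) S := by
  have h : ContinuousOn (fun p => ((round (g p) : ℤ) : ℝ)) S := hg.congr fun p hp => by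
    obtain ⟨n, hn⟩ := hint p hp
    simp [hn]
  exact Int.isClosedEmbedding_coe_real.isEmbedding.isInducing.continuousOn_iff.2 h

theorem continuousOn_cechDelta {A : Type*} [AddCommGroup A] [TopologicalSpace A]
    [IsTopologicalAddGroup A] {n : ℕ} {f : (Fin (n + 1) → M) → M → A}
    {𝒰 : PointedCover M} (hf : ∀ x, ContinuousOn (f x) (𝒰.inter x)) (x : Fin (n + 2) → M) :
    ContinuousOn (cechDelta n f x) (𝒰.inter x) := by
  change ContinuousOn (fun p => ∑ i : Fin (n + 2), (-1 : ℤ) ^ (i : ℕ) • f (x ∘ i.succAbove) p) _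
  refine continuousOn_finsetSum _ fun i _ => ?_
  exact ((hf (x ∘ i.succAbove)).mono (𝒰.inter_subset_face x i)).const_smul ((-1 : ℤ) ^ (i : ℕ))

/-- A real cochain whose differential is integral yields an integral cocycle. -/
theorem exists_cechCocycle_of_integral {𝒰 : PointedCover M} {f : (Fin 3 → M) → M → ℝ}
    (hf : ∀ x, ContinuousOn (f x) (𝒰.inter x))
    (hint : ∀ x, ∀ p ∈ 𝒰.inter x, ∃ n : ℤ, cechDelta 2 f x p = n) :
    ∃ n : cechCocycles M 3, ∀ x, ∀ p ∈ 𝒰.inter x, ((n.1 x p : ℤ) : ℝ) = cechDelta 2 f x p := by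
  have hr : ∀ x, ∀ p ∈ 𝒰.inter x, ((round (cechDelta 2 f x p) : ℤ) : ℝ) = cechDelta 2 f x p := by
    intro x p hp
    obtain ⟨n, hn⟩ := hint x p hp
    simp [hn]
  refine ⟨⟨fun x p => round (cechDelta 2 f x p), ⟨𝒰, fun x => ?_⟩, 𝒰, fun x p hp => ?_⟩, hr⟩
  · exact continuousOn_round_of_int (continuousOn_cechDelta hf x) (hint x)
  · have h := cechDelta_cechDelta_two f x p
    have hface := fun i => hr _ _ (𝒰.inter_subset_face x i hp)
    have : ((cechDelta 3 (fun x p => round (cechDelta 2 f x p)) x p : ℤ) : ℝ) = 0 := by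
      rw [← h]
      simp only [cechDelta, AddMonoidHom.coe_mk, ZeroHom.coe_mk] at hface ⊢
      push_cast
      refine Finset.sum_congr rfl fun i _ => ?_
      rw [← hface i]
      simp
    exact_mod_cast this

/-- On a paracompact Hausdorff space, a local property of finite families of indices of an open
cover holds on the intersections of a sufficiently fine refinement. -/
theorem exists_pointedCover_refinement [T2Space M] [ParacompactSpace M] {ι : Type*} {n : ℕ}
    (V : ι → Set M) (hV : ∀ i, IsOpen (V i)) (hcov : ∀ p, ∃ i, p ∈ V i)
    (Q : (Fin (n + 1) → ι) → Set M → Prop) (hmono : ∀ t S S', S' ⊆ S → Q t S → Q t S')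
    (hempty : ∀ t, Q t ∅)
    (hloc : ∀ t p, (∀ k, p ∈ V (t k)) → ∃ O, IsOpen O ∧ p ∈ O ∧ Q t O) :
    ∃ (𝒰 : PointedCover M) (i : M → ι), (∀ x, 𝒰.U x ⊆ V (i x)) ∧
      ∀ x : Fin (n + 1) → M, Q (i ∘ x) (𝒰.inter x) := by
  classical
  obtain ⟨V', hV'o, hV'c, hV'lf, hV'V⟩ :=
    precise_refinement V hV (Set.iUnion_eq_univ_iff.2 hcov)
  obtain ⟨W, hWc, hWo, hWV⟩ := exists_iUnion_eq_closure_subset hV'o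
    (fun x => hV'lf.point_finite x) hV'c
  have hWlf : LocallyFinite fun i => closure (W i) := hV'lf.subset hWV
  choose i hi using fun p => Set.iUnion_eq_univ_iff.1 hWc p
  -- Local finiteness leaves only finitely many tuples `t` to handle at each `x`, so the
  -- neighbourhoods `O x t` can be intersected.
  have hJ : ∀ x, {j | x ∈ closure (W j)}.Finite := fun x => hWlf.point_finite x
  have hT : ∀ x, {t : Fin (n + 1) → ι | ∀ k, x ∈ closure (W (t k))}.Finite := fun x =>
    (Set.Finite.pi fun _ => hJ x).subset fun t ht k _ => ht k
  have hO : ∀ x (t : Fin (n + 1) → ι), ∃ O, IsOpen O ∧ x ∈ O ∧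
      ((∀ k, x ∈ closure (W (t k))) → Q t O) := by
    intro x t
    by_cases h : ∀ k, x ∈ closure (W (t k))
    · obtain ⟨O, h1, h2, h3⟩ := hloc t x fun k => hV'V _ (hWV _ (h k))
      exact ⟨O, h1, h2, fun _ => h3⟩
    · exact ⟨Set.univ, isOpen_univ, trivial, fun h' => absurd h' h⟩
  choose O hOo hxO hOQ using hO
  -- Removing every `closure (W j)` that misses `x` leaves an open set, as a locally finite union of
  -- closed sets is closed. A point of `A x` can then lie in `W j` only if `x ∈ closure (W j)`.
  let A : M → Set M := fun x => (⋃ j ∈ {j | x ∉ closure (W j)}, closure (W j))ᶜ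
  have hA : ∀ x, IsOpen (A x) := fun x => by
    have : (⋃ j ∈ {j | x ∉ closure (W j)}, closure (W j)) =
        ⋃ j : {j | x ∉ closure (W j)}, closure (W j) := by
      rw [Set.biUnion_eq_iUnion]
    simp only [A, this]
    exact ((hWlf.comp_injective Subtype.val_injective).isClosed_iUnion
      fun _ => isClosed_closure).isOpen_compl
  refine ⟨⟨fun x => W (i x) ∩ A x ∩ ⋂ t ∈ {t : Fin (n + 1) → ι | ∀ k, x ∈ closure (W (t k))}, O x t,
    fun x => ((hWo _).inter (hA x)).inter ((hT x).isOpen_biInter fun t _ => hOo x t),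
    fun x => ⟨⟨hi x, by simp [A]⟩, by simpa using fun t _ => hxO x t⟩⟩, i,
    fun x p hp => hV'V _ (hWV _ (subset_closure hp.1.1)), fun x => ?_⟩
  rcases Set.eq_empty_or_nonempty (PointedCover.inter _ x) with h | ⟨q, hq⟩
  · rw [h]; exact hempty _
  · have hq := Set.mem_iInter.1 hq
    -- A common point `q` lies both in `A (x 0)` and in each `W (i (x k))`. Hence the tuple `i ∘ x`
    -- is among those handled at the single point `x 0`, and the whole intersection lies in `O (x 0)
    -- (i ∘ x)`.
    have hk : ∀ k, x 0 ∈ closure (W (i (x k))) := by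
      intro k
      by_contra hcon
      have h1 := (hq 0).1.2
      simp only [A, Set.mem_compl_iff, Set.mem_iUnion, not_exists] at h1
      exact h1 (i (x k)) hcon (subset_closure (hq k).1.1)
    refine hmono _ (O (x 0) (i ∘ x)) _ (fun p hp => ?_) (hOQ (x 0) (i ∘ x) hk)
    have := (Set.mem_iInter.1 hp 0).2
    simp only [Set.mem_iInter] at this
    exact this _ hk

/-- A continuous unit complex function has a continuous logarithm locally. -/
theorem exists_open_log {S : Set M} (hS : IsOpen S) {h : M → ℂ} (hh : ContinuousOn h S)
    (hn : ∀ p ∈ S, ‖h p‖ = 1) {p : M} (hp : p ∈ S) :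
    ∃ O, IsOpen O ∧ p ∈ O ∧ ∃ k : M → ℝ, ContinuousOn k O ∧
      ∀ q ∈ O, h q = Complex.exp (2 * Real.pi * Complex.I * k q) := by
  have hp0 : h p ≠ 0 := fun h0 => by simpa [h0] using hn p hp
  have hquot : ContinuousOn (fun q => h q / h p) S := hh.div_const _
  -- Dividing by `h p` moves the value at `p` to 1, away from the branch cut. The constant argument
  -- of `h p` is added back in the logarithm.
  refine ⟨S ∩ (fun q => h q / h p) ⁻¹' Complex.slitPlane,
    hquot.isOpen_inter_preimage hS Complex.isOpen_slitPlane, ⟨hp, by simp [hp0]⟩,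
    fun q => ((h q / h p).arg + (h p).arg) / (2 * Real.pi), ?_, ?_⟩
  · refine ContinuousOn.div_const (ContinuousOn.add ?_ continuousOn_const) _
    intro q hq
    exact ContinuousAt.comp_continuousWithinAt (f := fun q => h q / h p)
      (Complex.continuousAt_arg hq.2) ((hquot q hq.1).mono Set.inter_subset_left)
  · intro q hq
    have h1 : ‖h q / h p‖ = 1 := by simp [hn q hq.1, hn p hp]
    have e1 := Complex.norm_mul_exp_arg_mul_I (h q / h p)
    have e2 := Complex.norm_mul_exp_arg_mul_I (h p)
    rw [h1] at e1
    rw [hn p hp] at e2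
    have hpi : (2 * Real.pi : ℂ) ≠ 0 := by simp [Real.pi_ne_zero]
    have : (2 * Real.pi * Complex.I *
        ((((h q / h p).arg + (h p).arg) / (2 * Real.pi) : ℝ) : ℂ)) =
        (h q / h p).arg * Complex.I + (h p).arg * Complex.I := by
      push_cast
      field_simp
    rw [this, Complex.exp_add]
    simp only [Complex.ofReal_one, one_mul] at e1 e2
    rw [e1, e2, div_mul_cancel₀ _ hp0]

theorem exists_int_of_exp_eq_one {a : ℝ}
    (h : Complex.exp (2 * Real.pi * Complex.I * a) = 1) : ∃ n : ℤ, a = n := by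
  obtain ⟨n, hn⟩ := Complex.exp_eq_one_iff.1 h
  refine ⟨n, ?_⟩
  have h2 : (2 * Real.pi * Complex.I : ℂ) ≠ 0 := Complex.two_pi_I_ne_zero
  have : (a : ℂ) = n := mul_left_cancel₀ h2 (by rw [hn]; ring)
  exact_mod_cast this

/-- If `exp (2πi f)` is the differential of a `U(1)`-valued cochain `h`, then `δf` is an integral
coboundary. -/
theorem mem_cechCoboundaries_of_exp_eq [T2Space M] [ParacompactSpace M] (𝒰 : PointedCover M)
    (f : (Fin 3 → M) → M → ℝ) (hf : ∀ x, ContinuousOn (f x) (𝒰.inter x))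
    (n : (Fin 4 → M) → M → ℤ)
    (hn : ∀ x, ∀ p ∈ 𝒰.inter x, ((n x p : ℤ) : ℝ) = cechDelta 2 f x p)
    (h : M → M → M → ℂ) (hh : ∀ x y, ContinuousOn (h x y) (𝒰.U x ∩ 𝒰.U y))
    (hnorm : ∀ x y, ∀ p ∈ 𝒰.U x ∩ 𝒰.U y, ‖h x y p‖ = 1)
    (hfh : ∀ x y z p, p ∈ 𝒰.U x → p ∈ 𝒰.U y → p ∈ 𝒰.U z →
      h x y p * h y z p = Complex.exp (2 * Real.pi * Complex.I * f ![x, y, z] p) * h x z p) :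
    n ∈ cechCoboundaries M 3 := by
  -- Refinement changes indices: the logarithms obtained are those of `h (r x) (r y)`, not of `h x
  -- y`. Intersecting with `𝒰` below keeps both the index `x` and the index `r x` usable on `𝒱.U x`.
  obtain ⟨𝒱', r, hr, hlog⟩ := exists_pointedCover_refinement (n := 1) 𝒰.U 𝒰.isOpen_U
    (fun p => ⟨p, 𝒰.mem_U p⟩)
    (fun t S => ∃ k : M → ℝ, ContinuousOn k S ∧
      ∀ q ∈ S, h (t 0) (t 1) q = Complex.exp (2 * Real.pi * Complex.I * k q))
    (fun t S S' hS ⟨k, h1, h2⟩ => ⟨k, h1.mono hS, fun q hq => h2 q (hS hq)⟩)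
    (fun t => ⟨0, continuousOn_empty _, fun q hq => absurd hq (Set.notMem_empty q)⟩)
    (fun t p hp => exists_open_log ((𝒰.isOpen_U _).inter (𝒰.isOpen_U _)) (hh _ _) (hnorm _ _)
      ⟨hp 0, hp 1⟩)
  choose l hl hlh using fun x y => hlog ![x, y]
  let 𝒱 := 𝒱'.inf 𝒰
  have hVU : ∀ x, 𝒱.U x ⊆ 𝒰.U x := fun x => Set.inter_subset_right
  have hVr : ∀ x, 𝒱.U x ⊆ 𝒰.U (r x) := fun x => Set.inter_subset_left.trans (hr x)
  have hV' : ∀ x y, 𝒱.U x ∩ 𝒱.U y ⊆ 𝒱'.inter ![x, y] := fun x y p hp =>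
    PointedCover.mem_inter_two.2 ⟨hp.1.1, hp.2.1⟩
  -- By `hfh` for the triples (x, y, r y) and (x, r x, r y), this is a logarithm of h_{x,y} h_{y,r
  -- y} / h_{x,r x}. That quotient differs from `h x y` by the differential of the 0-cochain h_{x,r
  -- x}, so it has the same differential as `h`.
  let k : M → M → M → ℝ := fun x y p =>
    l x y p + f ![x, y, r y] p - f ![x, r x, r y] p
  have hk : ∀ x y, ContinuousOn (k x y) (𝒱.U x ∩ 𝒱.U y) := by
    intro x y
    refine (((hl x y).mono (hV' x y)).add ((hf _).mono fun p hp => ?_)).sub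
      ((hf _).mono fun p hp => ?_)
    · exact PointedCover.mem_inter_three.2 ⟨hVU _ hp.1, hVU _ hp.2, hVr _ hp.2⟩
    · exact PointedCover.mem_inter_three.2 ⟨hVU _ hp.1, hVr _ hp.1, hVr _ hp.2⟩
  have hne : ∀ {x y p}, p ∈ 𝒰.U x → p ∈ 𝒰.U y → h x y p ≠ 0 := fun {x y p} hx hy h0 => by
    simpa [h0] using hnorm x y p ⟨hx, hy⟩
  have hexp : ∀ x y p, p ∈ 𝒱.U x → p ∈ 𝒱.U y → h x y p * h y (r y) p =
      Complex.exp (2 * Real.pi * Complex.I * k x y p) * h x (r x) p := by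
    intro x y p hx hy
    have e1 := hfh x y (r y) p (hVU _ hx) (hVU _ hy) (hVr _ hy)
    have e2 := hfh x (r x) (r y) p (hVU _ hx) (hVr _ hx) (hVr _ hy)
    have e3 : h (r x) (r y) p = Complex.exp (2 * Real.pi * Complex.I * l x y p) :=
      hlh x y p (hV' x y ⟨hx, hy⟩)
    have e4 : (2 * Real.pi * Complex.I * k x y p : ℂ) = 2 * Real.pi * Complex.I * l x y p +
        2 * Real.pi * Complex.I * f ![x, y, r y] p -
          2 * Real.pi * Complex.I * f ![x, r x, r y] p := by
      simp only [k]; push_cast; ring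
    rw [e4, Complex.exp_sub, Complex.exp_add, ← e3, e1]
    field_simp
    rw [mul_comm, ← e2]
    ring
  -- `m'` is f − δk. Its exponential is 1, so it is integral, and δm' = δf because δδ = 0.
  let m' : (Fin 3 → M) → M → ℝ := fun x p =>
    f x p - (k (x 0) (x 1) p + k (x 1) (x 2) p - k (x 0) (x 2) p)
  have hm'c : ∀ x, ContinuousOn (m' x) (𝒱.inter x) := by
    intro x
    refine ((hf x).mono (𝒱'.inter_inf_right 𝒰 x)).sub
      ((((hk _ _).mono ?_).add ((hk _ _).mono ?_)).sub ((hk _ _).mono ?_)) <;>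
    · intro p hp
      have := PointedCover.mem_inter_three.1 hp
      exact ⟨by tauto, by tauto⟩
  have hint : ∀ x, ∀ p ∈ 𝒱.inter x, ∃ a : ℤ, m' x p = a := by
    intro x p hp
    obtain ⟨h0, h1, h2⟩ := PointedCover.mem_inter_three.1 hp
    apply exists_int_of_exp_eq_one
    have e0 := hfh _ _ _ p (hVU _ h0) (hVU _ h1) (hVU _ h2)
    have ex : ![x 0, x 1, x 2] = x := by ext j; fin_cases j <;> rfl
    rw [ex] at e0
    have e1 := hexp _ _ p h0 h1
    have e2 := hexp _ _ p h1 h2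
    have e3 := hexp _ _ p h0 h2
    have e4 : (2 * Real.pi * Complex.I * m' x p : ℂ) = 2 * Real.pi * Complex.I * f x p +
        2 * Real.pi * Complex.I * k (x 0) (x 2) p -
          (2 * Real.pi * Complex.I * k (x 0) (x 1) p +
            2 * Real.pi * Complex.I * k (x 1) (x 2) p) := by
      simp only [m']; push_cast; ring
    rw [e4, Complex.exp_sub, Complex.exp_add, Complex.exp_add, div_eq_one_iff_eq
      (mul_ne_zero (Complex.exp_ne_zero _) (Complex.exp_ne_zero _))]
    have n0 := hne (hVU _ h0) (hVr _ h0)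
    have n1 := hne (hVU _ h1) (hVr _ h1)
    have n2 := hne (hVU _ h2) (hVr _ h2)
    apply mul_right_cancel₀ n0
    apply mul_right_cancel₀ n1
    calc _ = Complex.exp (2 * Real.pi * Complex.I * f x p) *
          (Complex.exp (2 * Real.pi * Complex.I * k (x 0) (x 2) p) * h (x 0) (r (x 0)) p) *
            h (x 1) (r (x 1)) p := by ring
      _ = (Complex.exp (2 * Real.pi * Complex.I * f x p) * h (x 0) (x 2) p) *
          h (x 2) (r (x 2)) p * h (x 1) (r (x 1)) p := by rw [← e3]; ring
      _ = (h (x 0) (x 1) p * h (x 1) (r (x 1)) p) * (h (x 1) (x 2) p * h (x 2) (r (x 2)) p) := by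
          rw [← e0]; ring
      _ = _ := by rw [e1, e2]; ring
  refine AddSubgroup.mem_sup.2 ⟨cechDelta 2 fun x p => round (m' x p),
    ⟨_, ⟨𝒱, fun x => continuousOn_round_of_int (hm'c x) (hint x)⟩, rfl⟩,
    n - cechDelta 2 fun x p => round (m' x p), ⟨𝒱, fun x p hp => ?_⟩, by abel⟩
  have hround : ∀ x, ∀ p ∈ 𝒱.inter x, ((round (m' x p) : ℤ) : ℝ) = m' x p := by
    intro x p hp
    obtain ⟨a, ha⟩ := hint x p hp
    simp [ha]
  obtain ⟨h0, h1, h2, h3⟩ := PointedCover.mem_inter_four.1 hp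
  have hnx := hn x p (𝒱'.inter_inf_right 𝒰 x hp)
  have : ((n x p - cechDelta 2 (fun x p => round (m' x p)) x p : ℤ) : ℝ) = 0 := by
    rw [Int.cast_sub, hnx, cechDelta_two_apply, cechDelta_two_apply]
    push_cast
    rw [hround _ p (PointedCover.mem_inter_three.2 ⟨h1, h2, h3⟩),
      hround _ p (PointedCover.mem_inter_three.2 ⟨h0, h2, h3⟩),
      hround _ p (PointedCover.mem_inter_three.2 ⟨h0, h1, h3⟩),
      hround _ p (PointedCover.mem_inter_three.2 ⟨h0, h1, h2⟩)]
    simp [m']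
    ring
  exact_mod_cast this

end Cech

/-! ### Continuous sections of hermitian bundles -/

section Sections

variable {EN HN N : Type*} [NormedAddCommGroup EN] [NormedSpace ℝ EN] [TopologicalSpace HN]
  {I : ModelWithCorners ℝ EN HN} [TopologicalSpace N] [ChartedSpace HN N]
  {B : Type*} [TopologicalSpace B] {ι : B → N} {T : Type*} [TopologicalSpace T]

theorem SmoothAlong.continuousOn (hι : Continuous ι) {f : B → ℂ} {u : Set B}
    (h : SmoothAlong I ι f u) : ContinuousOn f u := by
  intro b hb
  obtain ⟨W, g, hW, hbW, hg, hfg⟩ := h b hb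
  have h1 : ContinuousAt (g ∘ ι) b :=
    ContinuousAt.comp (hg.continuousOn.continuousAt (hW.mem_nhds hbW)) hι.continuousAt
  exact h1.continuousWithinAt.congr_of_eventuallyEq hfg (hfg.self_of_nhdsWithin hb)

/-- The pull-back of a function that is smooth on a subspace, along a map that extends smoothly. -/
theorem SmoothAlong.comp {EN' HN' N' : Type*} [NormedAddCommGroup EN'] [NormedSpace ℝ EN']
    [TopologicalSpace HN'] {I' : ModelWithCorners ℝ EN' HN'} [TopologicalSpace N']
    [ChartedSpace HN' N'] {B' : Type*} [TopologicalSpace B'] {ι' : B' → N'} {f : B → ℂ} {u : Set B}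
    (h : SmoothAlong I ι f u) {φ : B' → B} (hφ : Continuous φ) {Φ : N' → N} {S : Set N'}
    (hS : IsOpen S) (hιS : ∀ b, ι' b ∈ S) (hΦ : ContMDiffOn I' I ∞ Φ S)
    (hφΦ : ∀ b, ι (φ b) = Φ (ι' b)) : SmoothAlong I' ι' (f ∘ φ) (φ ⁻¹' u) := by
  intro b hb
  obtain ⟨W, g, hW, hbW, hg, hfg⟩ := h (φ b) hb
  refine ⟨S ∩ Φ ⁻¹' W, g ∘ Φ, hΦ.continuousOn.isOpen_inter_preimage hS hW, ⟨hιS b, ?_⟩,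
    hg.comp' hΦ, ?_⟩
  · rw [Set.mem_preimage, ← hφΦ]; exact hbW
  · have : Filter.Tendsto φ (𝓝[φ ⁻¹' u] b) (𝓝[u] (φ b)) :=
      hφ.continuousWithinAt.tendsto_nhdsWithin fun _ h => h
    filter_upwards [this.eventually hfg] with b' hb'
    simp only [Function.comp, hb', hφΦ]

theorem OrthonormalBasis.inner_smul_zero {F : Type*} [NormedAddCommGroup F] [InnerProductSpace ℂ F]
    (b : OrthonormalBasis (Fin 1) ℂ F) (v : F) : inner ℂ (b 0) v • b 0 = v := by
  simpa using b.sum_repr' v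

/-- In a hermitian line, every vector is a multiple of any unit vector. -/
theorem OrthonormalBasis.inner_smul_of_norm_eq_one {F : Type*} [NormedAddCommGroup F]
    [InnerProductSpace ℂ F] (b : OrthonormalBasis (Fin 1) ℂ F) {u : F} (hu : ‖u‖ = 1) (v : F) :
    inner ℂ u v • u = v := by
  have hfin : Module.finrank ℂ F = 1 := by simpa using Module.finrank_eq_card_basis b.toBasis
  have hu0 : u ≠ 0 := fun h => by simp [h] at hu
  obtain ⟨c, rfl⟩ := (finrank_eq_one_iff_of_nonzero' u hu0).1 hfin v
  rw [inner_smul_right, inner_self_eq_norm_sq_to_K, hu]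
  simp

namespace HermitianBundle

/-- A family of vectors of a hermitian bundle, over a map `φ` to the base, that is continuous in
the frames of the atlas. -/
def ContinuousSection {r : ℕ} (V : HermitianBundle I ι r) (φ : T → B) (v : ∀ t, V.fiber (φ t)) :
    Prop :=
  ∀ e ∈ V.atlas, ∀ i, ContinuousOn (fun t => inner ℂ (e.basis (φ t) i) (v t)) (φ ⁻¹' e.dom)

variable {r : ℕ} {V : HermitianBundle I ι r} {φ : T → B}

theorem ContinuousSection.comp {v : ∀ t, V.fiber (φ t)} (hv : V.ContinuousSection φ v)
    {S : Type*} [TopologicalSpace S] {ψ : S → T} (hψ : Continuous ψ) :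
    V.ContinuousSection (fun s => φ (ψ s)) (fun s => v (ψ s)) := fun e he i =>
  (hv e he i).comp hψ.continuousOn fun _ h => h

theorem continuousSection_basis (hι : Continuous ι) (hφ : Continuous φ) {e : LocalFrame V.fiber r}
    (he : e ∈ V.atlas) (hmem : ∀ t, φ t ∈ e.dom) (i : Fin r) :
    V.ContinuousSection φ fun t => e.basis (φ t) i := fun e' he' j =>
  ((V.smooth_transition e' he' e he j i).continuousOn hι).comp hφ.continuousOn
    fun t ht => ⟨ht, hmem t⟩

/-- Parseval in a local frame expresses the inner product through the continuous coordinates. -/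
theorem ContinuousSection.inner {v w : ∀ t, V.fiber (φ t)} (hφ : Continuous φ)
    (hv : V.ContinuousSection φ v) (hw : V.ContinuousSection φ w) :
    Continuous fun t => inner ℂ (v t) (w t) := by
  refine continuous_iff_continuousAt.2 fun t => ?_
  obtain ⟨e, he, hte⟩ := V.exists_mem_dom (φ t)
  have hn : φ ⁻¹' e.dom ∈ 𝓝 t := ((V.isOpen_dom e he).preimage hφ).mem_nhds hte
  have : (fun t => Inner.inner ℂ (v t) (w t)) = fun t => ∑ i,
      (starRingEnd ℂ) (Inner.inner ℂ (e.basis (φ t) i) (v t)) *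
        Inner.inner ℂ (e.basis (φ t) i) (w t) := by
    funext t
    rw [← (e.basis (φ t)).sum_inner_mul_inner]
    simp_rw [inner_conj_symm]
  rw [this]
  refine tendsto_finsetSum _ fun i _ => ?_
  exact (Complex.continuous_conj.continuousAt.comp ((hv e he i).continuousAt hn)).mul
    ((hw e he i).continuousAt hn)

end HermitianBundle

end Sections

/-! ### Continuity of the gerbe product and of the module action -/

namespace BundleGerbe

variable {EM HM EY HY : Type*}
    [NormedAddCommGroup EM] [NormedSpace ℝ EM] [TopologicalSpace HM]
    [NormedAddCommGroup EY] [NormedSpace ℝ EY] [TopologicalSpace HY]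
    {IM : ModelWithCorners ℝ EM HM} {IY : ModelWithCorners ℝ EY HY}
    {M Y : Type*}
    [TopologicalSpace M] [ChartedSpace HM M] [TopologicalSpace Y] [ChartedSpace HY Y]
    {G : BundleGerbe IM IY M Y} {T : Type*} [TopologicalSpace T]

theorem norm_mul_tmul {y₁ y₂ y₃ : Y} (h₁₂ : G.π y₁ = G.π y₂) (h₂₃ : G.π y₂ = G.π y₃)
    (a : G.L.fiber ⟨(y₁, y₂), h₁₂⟩) (b : G.L.fiber ⟨(y₂, y₃), h₂₃⟩) :
    ‖G.mul y₁ y₂ y₃ h₁₂ h₂₃ (a ⊗ₜ b)‖ = ‖a‖ * ‖b‖ := by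
  rw [LinearIsometryEquiv.norm_map, TensorProduct.norm_tmul]

theorem inner_smul_of_norm_eq_one {q : FibreProd₂ G.π} {u : G.L.fiber q} (hu : ‖u‖ = 1)
    (v : G.L.fiber q) : inner ℂ u v • u = v := by
  obtain ⟨e, -, -⟩ := G.L.exists_mem_dom q
  exact (e.basis q).inner_smul_of_norm_eq_one hu v

theorem norm_inner_of_norm_eq_one {q : FibreProd₂ G.π} {u v : G.L.fiber q} (hu : ‖u‖ = 1)
    (hv : ‖v‖ = 1) : ‖(inner ℂ u v : ℂ)‖ = 1 := by
  have := congrArg norm (inner_smul_of_norm_eq_one hu v)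
  rwa [norm_smul, hu, hv, mul_one] at this

/-- The product of continuous sections of the line bundle of a bundle gerbe is continuous. -/
theorem continuousSection_mul {y₁ y₂ y₃ : T → Y} (hy₁ : Continuous y₁) (hy₂ : Continuous y₂)
    (hy₃ : Continuous y₃) (h₁₂ : ∀ t, G.π (y₁ t) = G.π (y₂ t))
    (h₂₃ : ∀ t, G.π (y₂ t) = G.π (y₃ t))
    {a : ∀ t, G.L.fiber ⟨(y₁ t, y₂ t), h₁₂ t⟩} {b : ∀ t, G.L.fiber ⟨(y₂ t, y₃ t), h₂₃ t⟩}
    (ha : G.L.ContinuousSection (fun t => ⟨(y₁ t, y₂ t), h₁₂ t⟩) a)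
    (hb : G.L.ContinuousSection (fun t => ⟨(y₂ t, y₃ t), h₂₃ t⟩) b) :
    G.L.ContinuousSection (fun t => ⟨(y₁ t, y₃ t), (h₁₂ t).trans (h₂₃ t)⟩)
      (fun t => G.mul _ _ _ (h₁₂ t) (h₂₃ t) (a t ⊗ₜ b t)) := by
  intro e'' he'' i t ht
  obtain rfl : i = 0 := Subsingleton.elim _ _
  obtain ⟨e, he, hte⟩ := G.L.exists_mem_dom ⟨(y₁ t, y₂ t), h₁₂ t⟩
  obtain ⟨e', he', hte'⟩ := G.L.exists_mem_dom ⟨(y₂ t, y₃ t), h₂₃ t⟩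
  have c₁ : Continuous fun t => (⟨(y₁ t, y₂ t), h₁₂ t⟩ : FibreProd₂ G.π) := by fun_prop
  have c₂ : Continuous fun t => (⟨(y₂ t, y₃ t), h₂₃ t⟩ : FibreProd₂ G.π) := by fun_prop
  have c₃ : Continuous fun t => (⟨(y₁ t, y₃ t), (h₁₂ t).trans (h₂₃ t)⟩ : FibreProd₂ G.π) := by
    fun_prop
  have c : Continuous fun t => (⟨(y₁ t, y₂ t, y₃ t), h₁₂ t, h₂₃ t⟩ : FibreProd₃ G.π) := by fun_prop
  have n₁ := ((G.L.isOpen_dom e he).preimage c₁).mem_nhds hte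
  have n₂ := ((G.L.isOpen_dom e' he').preimage c₂).mem_nhds hte'
  have n₃ := ((G.L.isOpen_dom e'' he'').preimage c₃).mem_nhds ht
  have k₃ := (((G.smooth_mul e he e' he' e'' he'').continuousOn continuous_subtype_val).comp
    c.continuousOn (Set.mapsTo_preimage _ _)).continuousAt
      (Filter.inter_mem n₁ (Filter.inter_mem n₂ n₃))
  have k := (((ha e he 0).continuousAt n₁).mul ((hb e' he' 0).continuousAt n₂)).mul k₃
  refine (k.congr (Filter.Eventually.of_forall fun s => ?_)).continuousWithinAt
  beta_reduce
  -- In a line, each factor is its coordinate times the frame vector. By bilinearity only the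
  -- product of frame vectors remains, which `smooth_mul` controls.
  conv_rhs => rw [← (e.basis ⟨(y₁ s, y₂ s), h₁₂ s⟩).inner_smul_zero (a s),
    ← (e'.basis ⟨(y₂ s, y₃ s), h₂₃ s⟩).inner_smul_zero (b s), TensorProduct.smul_tmul_smul,
    map_smul, inner_smul_right]
  rfl

/-- The matrix of the action of a continuous section of the line bundle, in local frames of a
bundle gerbe module, is continuous. -/
theorem Module.continuous_inner_act {r : ℕ} (E : G.Module r) {y₁ y₂ : T → Y} (hy₁ : Continuous y₁)
    (hy₂ : Continuous y₂) (h₁₂ : ∀ t, G.π (y₁ t) = G.π (y₂ t))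
    {a : ∀ t, G.L.fiber ⟨(y₁ t, y₂ t), h₁₂ t⟩}
    (ha : G.L.ContinuousSection (fun t => ⟨(y₁ t, y₂ t), h₁₂ t⟩) a)
    {e e' : LocalFrame E.E.fiber r} (he : e ∈ E.E.atlas) (he' : e' ∈ E.E.atlas)
    (h₁ : ∀ t, y₁ t ∈ e.dom) (h₂ : ∀ t, y₂ t ∈ e'.dom) (i j : Fin r) :
    Continuous fun t => (inner ℂ (e.basis (y₁ t) i)
      (E.act _ _ (h₁₂ t) (a t ⊗ₜ e'.basis (y₂ t) j)) : ℂ) := by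
  refine continuous_iff_continuousAt.2 fun t => ?_
  obtain ⟨l, hl, htl⟩ := G.L.exists_mem_dom ⟨(y₁ t, y₂ t), h₁₂ t⟩
  have c : Continuous fun t => (⟨(y₁ t, y₂ t), h₁₂ t⟩ : FibreProd₂ G.π) := by fun_prop
  have n := ((G.L.isOpen_dom l hl).preimage c).mem_nhds htl
  have k := (((E.smooth_act l hl e he e' he' i j).continuousOn continuous_subtype_val).comp
    c.continuousOn (Set.mapsTo_preimage _ _)).continuousAt
      (Filter.mem_of_superset n fun s hs => ⟨hs, h₁ s, h₂ s⟩)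
  refine (((ha l hl 0).continuousAt n).mul k).congr (Filter.Eventually.of_forall fun s => ?_)
  beta_reduce
  conv_rhs => rw [← (l.basis ⟨(y₁ s, y₂ s), h₁₂ s⟩).inner_smul_zero (a s),
    ← TensorProduct.smul_tmul', map_smul, inner_smul_right]
  rfl

end BundleGerbe

/-- This passes from functions on an overlap, where the sections live, to cochain components, which
are functions on all of `M` with irrelevant values elsewhere. -/
theorem exists_continuousOn_eq {M : Type*} [TopologicalSpace M] {S : Set M} {g : S → ℂ}
    (hg : Continuous g) : ∃ H : M → ℂ, ContinuousOn H S ∧ ∀ p : S, H p = g p := by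
  have h : ∀ p : S, Function.extend Subtype.val g 0 p = g p :=
    fun p => Subtype.val_injective.extend_apply g 0 p
  refine ⟨Function.extend Subtype.val g 0, continuousOn_iff_continuous_domRestrict.2 ?_, h⟩
  exact hg.congr fun p => (h p).symm

namespace BundleGerbe

variable {EM HM EY HY : Type*}
    [NormedAddCommGroup EM] [NormedSpace ℝ EM] [TopologicalSpace HM]
    [NormedAddCommGroup EY] [NormedSpace ℝ EY] [TopologicalSpace HY]
    {IM : ModelWithCorners ℝ EM HM} {IY : ModelWithCorners ℝ EY HY}
    {M Y : Type*}
    [TopologicalSpace M] [ChartedSpace HM M] [TopologicalSpace Y] [ChartedSpace HY Y]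
    {G : BundleGerbe IM IY M Y}

/-! ### Existence of the choices that define the Dixmier-Douady class -/

/-- For a fine enough cover, with local sections `s`, the pull-backs of the line bundle by
`(s x, s y)` are trivial on the double intersections. -/
theorem exists_sections_frames [T2Space M] [ParacompactSpace M] (G : BundleGerbe IM IY M Y) :
    ∃ (𝒰 : PointedCover M) (s : M → M → Y), (∀ x, ContMDiffOn IM IY ∞ (s x) (𝒰.U x)) ∧
      (∀ x, ∀ p ∈ 𝒰.U x, G.π (s x p) = p) ∧
      ∀ x y, ∃ e ∈ G.L.atlas, ∀ p (h : G.π (s x p) = G.π (s y p)), p ∈ 𝒰.U x → p ∈ 𝒰.U y →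
        (⟨(s x p, s y p), h⟩ : FibreProd₂ G.π) ∈ e.dom := by
  choose U s hU hxU hs hπ using G.locallySplit
  obtain ⟨𝒱, i, hi, hQ⟩ := exists_pointedCover_refinement (n := 1) U hU (fun p => ⟨p, hxU p⟩)
    (fun t S => ∃ e ∈ G.L.atlas, ∀ p (h : G.π (s (t 0) p) = G.π (s (t 1) p)), p ∈ S →
        (⟨(s (t 0) p, s (t 1) p), h⟩ : FibreProd₂ G.π) ∈ e.dom)
    (fun t S S' hS ⟨e, he, h⟩ => ⟨e, he, fun p hp hpS => h p hp (hS hpS)⟩)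
    (fun t => by
      -- Over the empty set any frame will do; a diagonal point shows that the atlas has one.
      obtain ⟨e, he, -⟩ := G.L.exists_mem_dom ⟨(s (t 0) (t 0), s (t 0) (t 0)), rfl⟩
      exact ⟨e, he, fun p h hp => absurd hp (Set.notMem_empty p)⟩)
    (fun t p hp => by
      let T := ↥(U (t 0) ∩ U (t 1))
      have h₀ : Continuous fun q : T => s (t 0) q :=
        continuousOn_iff_continuous_domRestrict.1
          ((hs (t 0)).continuousOn.mono Set.inter_subset_left)
      have h₁ : Continuous fun q : T => s (t 1) q :=
        continuousOn_iff_continuous_domRestrict.1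
          ((hs (t 1)).continuousOn.mono Set.inter_subset_right)
      let φ : T → FibreProd₂ G.π := fun q =>
        ⟨(s (t 0) q, s (t 1) q), (hπ _ _ q.2.1).trans (hπ _ _ q.2.2).symm⟩
      have hφ : Continuous φ := (h₀.prodMk h₁).subtype_mk _
      obtain ⟨e, he, hpe⟩ := G.L.exists_mem_dom (φ ⟨p, hp 0, hp 1⟩)
      refine ⟨Subtype.val '' (φ ⁻¹' e.dom), ((hU _).inter (hU _)).isOpenMap_subtype_val _
        ((G.L.isOpen_dom e he).preimage hφ), ⟨_, hpe, rfl⟩, e, he, ?_⟩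
      rintro _ h ⟨q, hq, rfl⟩
      exact hq)
  refine ⟨𝒱, fun x => s (i x), fun x => (hs _).mono (hi x), fun x p hp => hπ _ _ (hi x hp),
    fun x y => ?_⟩
  obtain ⟨e, he, h⟩ := hQ ![x, y]
  exact ⟨e, he, fun p hp hx hy => h p hp (PointedCover.mem_inter_two.2 ⟨hx, hy⟩)⟩

/-- Frame vectors on double overlaps serve as `σ`. Their products are unit multiples `H` of the
frame on the outer pair, and a second refinement, for triples, supplies the logarithms of `H`. -/
theorem nonempty_dixmierDouadyData [T2Space M] [ParacompactSpace M] (G : BundleGerbe IM IY M Y) :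
    Nonempty G.DixmierDouadyData := by
  obtain ⟨𝒰, s, hs, hπ, he⟩ := G.exists_sections_frames
  choose e he hmem using he
  have hsπ : ∀ {x y p}, p ∈ 𝒰.U x → p ∈ 𝒰.U y → G.π (s x p) = G.π (s y p) :=
    fun hx hy => (hπ _ _ hx).trans (hπ _ _ hy).symm
  have hg : ∀ t : Fin 3 → M, ∃ H : M → ℂ, ContinuousOn H (𝒰.inter t) ∧
      ∀ p (h₀ : p ∈ 𝒰.U (t 0)) (h₁ : p ∈ 𝒰.U (t 1)) (h₂ : p ∈ 𝒰.U (t 2)), H p =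
        inner ℂ ((e (t 0) (t 2)).basis ⟨(s (t 0) p, s (t 2) p), hsπ h₀ h₂⟩ 0)
          (G.mul _ _ _ (hsπ h₀ h₁) (hsπ h₁ h₂)
            ((e (t 0) (t 1)).basis ⟨(s (t 0) p, s (t 1) p), hsπ h₀ h₁⟩ 0 ⊗ₜ
              (e (t 1) (t 2)).basis ⟨(s (t 1) p, s (t 2) p), hsπ h₁ h₂⟩ 0)) := by
    intro t
    have hm : ∀ (q : ↥(𝒰.inter t)) k, (q : M) ∈ 𝒰.U (t k) := fun q k => Set.mem_iInter.1 q.2 k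
    have hc : ∀ k, Continuous fun q : ↥(𝒰.inter t) => s (t k) q := fun k =>
      continuousOn_iff_continuous_domRestrict.1
        ((hs (t k)).continuousOn.mono fun q hq => hm ⟨q, hq⟩ k)
    have hφ : ∀ j k, Continuous fun q : ↥(𝒰.inter t) =>
        (⟨(s (t j) q, s (t k) q), hsπ (hm q j) (hm q k)⟩ : FibreProd₂ G.π) := fun j k =>
      ((hc j).prodMk (hc k)).subtype_mk _
    have hsec : ∀ j k, G.L.ContinuousSection
        (fun q : ↥(𝒰.inter t) => ⟨(s (t j) q, s (t k) q), hsπ (hm q j) (hm q k)⟩)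
        (fun q => (e (t j) (t k)).basis _ 0) := fun j k =>
      HermitianBundle.continuousSection_basis continuous_subtype_val (hφ j k) (he _ _)
        (fun q => hmem _ _ _ _ (hm q j) (hm q k)) 0
    obtain ⟨H, hH, hHp⟩ := exists_continuousOn_eq ((hsec 0 2).inner (hφ 0 2)
      (continuousSection_mul (hc 0) (hc 1) (hc 2) _ _ (hsec 0 1) (hsec 1 2)))
    exact ⟨H, hH, fun p h₀ h₁ h₂ => hHp ⟨p, PointedCover.mem_inter_three.2 ⟨h₀, h₁, h₂⟩⟩⟩
  choose H hH hHp using hg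
  obtain ⟨𝒱, i, hi, hQ⟩ := exists_pointedCover_refinement (n := 2) 𝒰.U 𝒰.isOpen_U
    (fun p => ⟨p, 𝒰.mem_U p⟩)
    (fun t S => ∃ k : M → ℝ, ContinuousOn k S ∧
      ∀ q ∈ S, H t q = Complex.exp (2 * Real.pi * Complex.I * k q))
    (fun t S S' hS ⟨k, h1, h2⟩ => ⟨k, h1.mono hS, fun q hq => h2 q (hS hq)⟩)
    (fun t => ⟨0, continuousOn_empty _, fun q hq => absurd hq (Set.notMem_empty q)⟩)
    (fun t p hp => exists_open_log (isOpen_iInter_of_finite fun k => 𝒰.isOpen_U (t k)) (hH t)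
      (fun q hq => by
        obtain ⟨h₀, h₁, h₂⟩ := PointedCover.mem_inter_three.1 hq
        rw [hHp t q h₀ h₁ h₂]
        apply norm_inner_of_norm_eq_one
        · exact OrthonormalBasis.norm_eq_one _ _
        · rw [norm_mul_tmul, OrthonormalBasis.norm_eq_one, OrthonormalBasis.norm_eq_one, mul_one])
      (Set.mem_iInter.2 hp))
  choose k hk hkH using hQ
  exact ⟨{
    cover := 𝒱
    s := fun x => s (i x)
    smooth_s := fun x => (hs _).mono (hi x)
    π_s := fun x p hp => hπ _ _ (hi x hp)
    σ := fun x y p => (e (i x) (i y)).basis _ 0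
    norm_σ := fun x y p => OrthonormalBasis.norm_eq_one _ _
    smooth_σ := fun x y e' he' => by
      have hc : ∀ z, 𝒱.U x ∩ 𝒱.U y ⊆ 𝒰.U (i z) →
          Continuous fun q : ↥(𝒱.U x ∩ 𝒱.U y) => s (i z) q := fun z hz =>
        continuousOn_iff_continuous_domRestrict.1 ((hs (i z)).continuousOn.mono hz)
      have hx : 𝒱.U x ∩ 𝒱.U y ⊆ 𝒰.U (i x) := fun q hq => hi x hq.1
      have hy : 𝒱.U x ∩ 𝒱.U y ⊆ 𝒰.U (i y) := fun q hq => hi y hq.2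
      have hφ : Continuous fun q : ↥(𝒱.U x ∩ 𝒱.U y) =>
          (⟨(s (i x) q, s (i y) q), hsπ (hx q.2) (hy q.2)⟩ : FibreProd₂ G.π) :=
        ((hc x hx).prodMk (hc y hy)).subtype_mk _
      have := (G.L.smooth_transition e' he' (e (i x) (i y)) (he _ _) 0 0).comp (I' := IM)
        (ι' := (Subtype.val : ↥(𝒱.U x ∩ 𝒱.U y) → M)) hφ
        (Φ := fun q => (s (i x) q, s (i y) q)) ((𝒱.isOpen_U x).inter (𝒱.isOpen_U y))
        (fun q => q.2) (((hs _).mono hx).prodMk ((hs _).mono hy)) (fun q => rfl)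
      convert this using 1
      · rfl
      · ext q
        exact ⟨fun h => ⟨h, hmem _ _ _ _ (hx q.2) (hy q.2)⟩, fun h => h.1⟩
    f := k
    continuousOn_f := hk
    mul_σ := fun x y z p hx hy hz => by
      rw [← hkH ![x, y, z] p (PointedCover.mem_inter_three.2 ⟨hx, hy, hz⟩),
        hHp _ p (hi x hx) (hi y hy) (hi z hz)]
      exact (inner_smul_of_norm_eq_one (OrthonormalBasis.norm_eq_one _ _) _).symm }⟩

/-! ### The Dixmier-Douady class is well defined -/

namespace DixmierDouadyData

variable (D : G.DixmierDouadyData)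

theorem continuousSection_σ (x y : M) : G.L.ContinuousSection
    (fun p : ↥(D.cover.U x ∩ D.cover.U y) =>
      ⟨(D.s x p, D.s y p), (D.π_s x p p.2.1).trans (D.π_s y p p.2.2).symm⟩) (D.σ x y) := by
  intro e he i
  obtain rfl : i = 0 := Subsingleton.elim _ _
  exact (D.smooth_σ x y e he).continuousOn continuous_subtype_val

theorem continuous_s {x : M} {S : Set M} (hS : S ⊆ D.cover.U x) :
    Continuous fun p : S => D.s x p :=
  continuousOn_iff_continuous_domRestrict.1 ((D.smooth_s x).continuousOn.mono hS)

/-- The two bracketings of σ_xy σ_yz σ_zw agree, and both are multiples of the nonzero vector σ_xw.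
This is what makes δf integral. -/
theorem exp_mul_exp {x y z w p : M} (hx : p ∈ D.cover.U x) (hy : p ∈ D.cover.U y)
    (hz : p ∈ D.cover.U z) (hw : p ∈ D.cover.U w) :
    Complex.exp (2 * Real.pi * Complex.I * D.f ![x, y, z] p) *
        Complex.exp (2 * Real.pi * Complex.I * D.f ![x, z, w] p) =
      Complex.exp (2 * Real.pi * Complex.I * D.f ![y, z, w] p) *
        Complex.exp (2 * Real.pi * Complex.I * D.f ![x, y, w] p) := by
  have h := G.mul_assoc _ _ _ _ ((D.π_s x p hx).trans (D.π_s y p hy).symm)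
    ((D.π_s y p hy).trans (D.π_s z p hz).symm) ((D.π_s z p hz).trans (D.π_s w p hw).symm)
    (D.σ x y ⟨p, hx, hy⟩) (D.σ y z ⟨p, hy, hz⟩) (D.σ z w ⟨p, hz, hw⟩)
  rw [D.mul_σ x y z p hx hy hz, D.mul_σ y z w p hy hz hw, ← TensorProduct.smul_tmul',
    TensorProduct.tmul_smul, map_smul, map_smul, D.mul_σ x z w p hx hz hw,
    D.mul_σ x y w p hx hy hw, smul_smul, smul_smul] at h
  refine smul_left_injective ℂ (fun h0 => ?_) h
  simpa [h0] using D.norm_σ x w ⟨p, hx, hw⟩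

theorem exists_cechCocycle : ∃ n : cechCocycles M 3,
    ∀ x, ∀ p ∈ D.cover.inter x, ((n.1 x p : ℤ) : ℝ) = cechDelta 2 D.f x p := by
  refine exists_cechCocycle_of_integral D.continuousOn_f fun x p hp => ?_
  obtain ⟨h0, h1, h2, h3⟩ := PointedCover.mem_inter_four.1 hp
  apply exists_int_of_exp_eq_one
  rw [cechDelta_two_apply]
  push_cast
  rw [mul_sub, mul_add, mul_sub, Complex.exp_sub, Complex.exp_add, Complex.exp_sub,
    div_eq_one_iff_eq (Complex.exp_ne_zero _), div_mul_eq_mul_div,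
    div_eq_iff (Complex.exp_ne_zero _)]
  exact (D.exp_mul_exp h0 h1 h2 h3).symm

end DixmierDouadyData

/-- If `σ` and `σ'` multiply up to `g` and `g'`, and `τ` intertwines `σ` with `σ'` up to `h`, then
`g / g'` is the differential of `h`. -/
theorem mul_eq_of_intertwining {y₁ y₂ y₃ z₁ z₂ z₃ : Y} (h₁₂ : G.π y₁ = G.π y₂)
    (h₂₃ : G.π y₂ = G.π y₃) (k₁₂ : G.π z₁ = G.π z₂) (k₂₃ : G.π z₂ = G.π z₃)
    (t₁ : G.π y₁ = G.π z₁) (t₂ : G.π y₂ = G.π z₂) (t₃ : G.π y₃ = G.π z₃)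
    {a₁₂ : G.L.fiber ⟨(y₁, y₂), h₁₂⟩} {a₂₃ : G.L.fiber ⟨(y₂, y₃), h₂₃⟩}
    {a₁₃ : G.L.fiber ⟨(y₁, y₃), h₁₂.trans h₂₃⟩}
    {b₁₂ : G.L.fiber ⟨(z₁, z₂), k₁₂⟩} {b₂₃ : G.L.fiber ⟨(z₂, z₃), k₂₃⟩}
    {b₁₃ : G.L.fiber ⟨(z₁, z₃), k₁₂.trans k₂₃⟩}
    {c₁ : G.L.fiber ⟨(y₁, z₁), t₁⟩} {c₂ : G.L.fiber ⟨(y₂, z₂), t₂⟩}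
    {c₃ : G.L.fiber ⟨(y₃, z₃), t₃⟩} (hb : ‖b₁₃‖ = 1) (hc : ‖c₁‖ = 1)
    {g g' u v w : ℂ} (hg : G.mul _ _ _ h₁₂ h₂₃ (a₁₂ ⊗ₜ a₂₃) = g • a₁₃)
    (hg' : G.mul _ _ _ k₁₂ k₂₃ (b₁₂ ⊗ₜ b₂₃) = g' • b₁₃)
    (hu : u • G.mul _ _ _ t₁ k₁₂ (c₁ ⊗ₜ b₁₂) = G.mul _ _ _ h₁₂ t₂ (a₁₂ ⊗ₜ c₂))
    (hv : v • G.mul _ _ _ t₂ k₂₃ (c₂ ⊗ₜ b₂₃) = G.mul _ _ _ h₂₃ t₃ (a₂₃ ⊗ₜ c₃))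
    (hw : w • G.mul _ _ _ t₁ (k₁₂.trans k₂₃) (c₁ ⊗ₜ b₁₃) =
      G.mul _ _ _ (h₁₂.trans h₂₃) t₃ (a₁₃ ⊗ₜ c₃)) :
    u * v * g' = g * w := by
  -- The product a₁₂ a₂₃ c₃ is computed in two ways. Merging a₁₂ a₂₃ first gives g w; moving `c` to
  -- the left past a₂₃ and then a₁₂, and merging b₁₂ b₂₃ last, gives u v g'. Both multiply c₁ b₁₃.
  have e := G.mul_assoc _ _ _ _ h₁₂ h₂₃ t₃ a₁₂ a₂₃ c₃
  rw [hg, ← hv, ← TensorProduct.smul_tmul', TensorProduct.tmul_smul, map_smul, map_smul, ← hw,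
    ← G.mul_assoc _ _ _ _ h₁₂ t₂ k₂₃, ← hu, ← TensorProduct.smul_tmul', map_smul,
    G.mul_assoc _ _ _ _ t₁ k₁₂ k₂₃, hg', TensorProduct.tmul_smul, map_smul, smul_smul, smul_smul,
    smul_smul] at e
  have hne : G.mul _ _ _ t₁ (k₁₂.trans k₂₃) (c₁ ⊗ₜ b₁₃) ≠ 0 := fun h0 => by
    simpa [norm_mul_tmul, hb, hc] using congrArg norm h0
  rw [smul_left_injective ℂ hne e]
  ring

theorem sub_mem_cechCoboundaries [T2Space M] [ParacompactSpace M] (D D' : G.DixmierDouadyData)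
    {n n' : (Fin 4 → M) → M → ℤ}
    (hn : ∀ x, ∀ p ∈ D.cover.inter x, ((n x p : ℤ) : ℝ) = cechDelta 2 D.f x p)
    (hn' : ∀ x, ∀ p ∈ D'.cover.inter x, ((n' x p : ℤ) : ℝ) = cechDelta 2 D'.f x p) :
    n - n' ∈ cechCoboundaries M 3 := by
  have ht : ∀ {x p}, p ∈ D.cover.U x → p ∈ D'.cover.U x → G.π (D.s x p) = G.π (D'.s x p) :=
    fun h h' => (D.π_s _ _ h).trans (D'.π_s _ _ h').symm
  have hs : ∀ {x y p}, p ∈ D.cover.U x → p ∈ D.cover.U y → G.π (D.s x p) = G.π (D.s y p) :=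
    fun h h' => (D.π_s _ _ h).trans (D.π_s _ _ h').symm
  have hs' : ∀ {x y p}, p ∈ D'.cover.U x → p ∈ D'.cover.U y → G.π (D'.s x p) = G.π (D'.s y p) :=
    fun h h' => (D'.π_s _ _ h).trans (D'.π_s _ _ h').symm
  have hφ : ∀ x, Continuous fun p : ↥(D.cover.U x ∩ D'.cover.U x) =>
      (⟨(D.s x p, D'.s x p), ht p.2.1 p.2.2⟩ : FibreProd₂ G.π) := fun x =>
    ((D.continuous_s Set.inter_subset_left).prodMk
      (D'.continuous_s Set.inter_subset_right)).subtype_mk _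
  -- The frame `l x` yields a unit section τ_x of `L` over (s_x, s'_x) near `x`, comparing the two
  -- local sections of `π`. The cover `𝒰` is shrunk to where it is available.
  choose l hl hxl using fun x : M => G.L.exists_mem_dom
    ⟨(D.s x x, D'.s x x), ht (D.cover.mem_U x) (D'.cover.mem_U x)⟩
  let 𝒰 : PointedCover M :=
    { U := fun x => Subtype.val ''
        ((fun p : ↥(D.cover.U x ∩ D'.cover.U x) =>
          (⟨(D.s x p, D'.s x p), ht p.2.1 p.2.2⟩ : FibreProd₂ G.π)) ⁻¹' (l x).dom)
      isOpen_U := fun x => ((D.cover.isOpen_U x).inter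
        (D'.cover.isOpen_U x)).isOpenMap_subtype_val _ ((G.L.isOpen_dom _ (hl x)).preimage (hφ x))
      mem_U := fun x => ⟨⟨x, D.cover.mem_U x, D'.cover.mem_U x⟩, hxl x, rfl⟩ }
  have hU : ∀ x, 𝒰.U x ⊆ D.cover.U x := by rintro x _ ⟨q, -, rfl⟩; exact q.2.1
  have hU' : ∀ x, 𝒰.U x ⊆ D'.cover.U x := by rintro x _ ⟨q, -, rfl⟩; exact q.2.2
  have hl' : ∀ x p (hp : p ∈ 𝒰.U x),
      (⟨(D.s x p, D'.s x p), ht (hU x hp) (hU' x hp)⟩ : FibreProd₂ G.π) ∈ (l x).dom := by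
    rintro x _ ⟨q, hq, rfl⟩
    exact hq
  -- `H x y` is the factor in σ_xy τ_y = H_xy τ_x σ'_xy.
  have hh : ∀ x y, ∃ H : M → ℂ, ContinuousOn H (𝒰.U x ∩ 𝒰.U y) ∧
      ∀ p (hx : p ∈ 𝒰.U x) (hy : p ∈ 𝒰.U y), H p =
        inner ℂ (G.mul _ _ _ (ht (hU x hx) (hU' x hx)) (hs' (hU' x hx) (hU' y hy))
            ((l x).basis ⟨(D.s x p, D'.s x p), ht (hU x hx) (hU' x hx)⟩ 0 ⊗ₜ
              D'.σ x y ⟨p, hU' x hx, hU' y hy⟩))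
          (G.mul _ _ _ (hs (hU x hx) (hU y hy)) (ht (hU y hy) (hU' y hy))
            (D.σ x y ⟨p, hU x hx, hU y hy⟩ ⊗ₜ
              (l y).basis ⟨(D.s y p, D'.s y p), ht (hU y hy) (hU' y hy)⟩ 0)) := by
    intro x y
    let T := ↥(𝒰.U x ∩ 𝒰.U y)
    have cx : Continuous fun p : T => D.s x p := D.continuous_s fun p hp => hU x hp.1
    have cy : Continuous fun p : T => D.s y p := D.continuous_s fun p hp => hU y hp.2
    have cx' : Continuous fun p : T => D'.s x p := D'.continuous_s fun p hp => hU' x hp.1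
    have cy' : Continuous fun p : T => D'.s y p := D'.continuous_s fun p hp => hU' y hp.2
    have hσ := (D.continuousSection_σ x y).comp (S := T)
      (ψ := fun p => ⟨p, hU x p.2.1, hU y p.2.2⟩) (by fun_prop)
    have hσ' := (D'.continuousSection_σ x y).comp (S := T)
      (ψ := fun p => ⟨p, hU' x p.2.1, hU' y p.2.2⟩) (by fun_prop)
    have hτx := HermitianBundle.continuousSection_basis (V := G.L) (T := T)
      (φ := fun p => ⟨(D.s x p, D'.s x p), ht (hU x p.2.1) (hU' x p.2.1)⟩)
      continuous_subtype_val ((cx.prodMk cx').subtype_mk _) (hl x) (fun p => hl' x p p.2.1) 0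
    have hτy := HermitianBundle.continuousSection_basis (V := G.L) (T := T)
      (φ := fun p => ⟨(D.s y p, D'.s y p), ht (hU y p.2.2) (hU' y p.2.2)⟩)
      continuous_subtype_val ((cy.prodMk cy').subtype_mk _) (hl y) (fun p => hl' y p p.2.2) 0
    obtain ⟨H, hH, hHp⟩ := exists_continuousOn_eq (HermitianBundle.ContinuousSection.inner
      ((cx.prodMk cy').subtype_mk _)
      (continuousSection_mul cx cx' cy' _ _ hτx hσ') (continuousSection_mul cx cy cy' _ _ hσ hτy))
    exact ⟨H, hH, fun p hx hy => hHp ⟨p, hx, hy⟩⟩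
  choose H hH hHp using hh
  have hunit : ∀ x y p (hx : p ∈ 𝒰.U x) (hy : p ∈ 𝒰.U y),
      ‖G.mul _ _ _ (ht (hU x hx) (hU' x hx)) (hs' (hU' x hx) (hU' y hy))
        ((l x).basis ⟨(D.s x p, D'.s x p), ht (hU x hx) (hU' x hx)⟩ 0 ⊗ₜ
          D'.σ x y ⟨p, hU' x hx, hU' y hy⟩)‖ = 1 := fun x y p hx hy => by
    rw [norm_mul_tmul, OrthonormalBasis.norm_eq_one, D'.norm_σ, mul_one]
  have hsmul := fun x y p hx hy => (congrArg (· • _) (hHp x y p hx hy)).trans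
    (inner_smul_of_norm_eq_one (hunit x y p hx hy) _)
  have hinter : ∀ {m} (x : Fin (m + 1) → M), 𝒰.inter x ⊆ D.cover.inter x :=
    fun x => Set.iInter_mono fun k => hU _
  have hinter' : ∀ {m} (x : Fin (m + 1) → M), 𝒰.inter x ⊆ D'.cover.inter x :=
    fun x => Set.iInter_mono fun k => hU' _
  refine mem_cechCoboundaries_of_exp_eq 𝒰 (D.f - D'.f)
    (fun x => ((D.continuousOn_f x).mono (hinter x)).sub
      ((D'.continuousOn_f x).mono (hinter' x))) _ (fun x p hp => ?_) H hH
    (fun x y p hp => ?_) (fun x y z p hx hy hz => ?_)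
  · rw [map_sub]
    simp only [Pi.sub_apply, Int.cast_sub, hn x p (hinter x hp), hn' x p (hinter' x hp)]
  · rw [hHp x y p hp.1 hp.2]
    refine norm_inner_of_norm_eq_one (hunit x y p hp.1 hp.2) ?_
    rw [norm_mul_tmul, OrthonormalBasis.norm_eq_one, D.norm_σ, mul_one]
  · have := mul_eq_of_intertwining _ _ _ _ _ _ _ (D'.norm_σ x z ⟨p, hU' x hx, hU' z hz⟩)
      (OrthonormalBasis.norm_eq_one _ _)
      (D.mul_σ x y z p (hU x hx) (hU y hy) (hU z hz))
      (D'.mul_σ x y z p (hU' x hx) (hU' y hy) (hU' z hz))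
      (hsmul x y p hx hy) (hsmul y z p hy hz) (hsmul x z p hx hz)
    simp only [Pi.sub_apply, Complex.ofReal_sub, mul_sub, Complex.exp_sub]
    rw [div_mul_eq_mul_div, eq_div_iff (Complex.exp_ne_zero _), this]

theorem isDixmierDouadyClass_iff [T2Space M] [ParacompactSpace M] (c : CechCohomology M 3) :
    G.IsDixmierDouadyClass c ↔ c = G.dixmierDouadyClass := by
  obtain ⟨D⟩ := G.nonempty_dixmierDouadyData
  obtain ⟨n, hn⟩ := D.exists_cechCocycle
  have hspec : G.IsDixmierDouadyClass G.dixmierDouadyClass :=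
    Classical.epsilon_spec (p := G.IsDixmierDouadyClass) ⟨_, D, n, hn, rfl⟩
  refine ⟨fun hc => ?_, fun hc => hc ▸ hspec⟩
  obtain ⟨D₁, n₁, hn₁, rfl⟩ := hc
  obtain ⟨D₂, n₂, hn₂, h₂⟩ := hspec
  rw [h₂, QuotientAddGroup.eq, AddSubgroup.mem_addSubgroupOf]
  have := sub_mem_cechCoboundaries D₂ D₁ hn₂ hn₁
  convert this using 1
  simp only [AddSubgroup.coe_add, AddSubgroup.coe_neg]
  abel

/-! ### Bundle gerbe modules and torsion -/

namespace Module

variable {r : ℕ}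

/-- The action is isometric and `a` is a unit vector, so v ↦ a · v preserves inner products. -/
theorem unitary_of_norm_eq_one (E : G.Module r) {y₁ y₂ : Y} (h : G.π y₁ = G.π y₂)
    {a : G.L.fiber ⟨(y₁, y₂), h⟩} (ha : ‖a‖ = 1)
    (b₁ : OrthonormalBasis (Fin r) ℂ (E.E.fiber y₁))
    (b₂ : OrthonormalBasis (Fin r) ℂ (E.E.fiber y₂)) :
    Matrix.of (fun i j => (inner ℂ (b₁ i) (E.act _ _ h (a ⊗ₜ b₂ j)) : ℂ)) ∈
      Matrix.unitaryGroup (Fin r) ℂ := by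
  rw [Matrix.mem_unitaryGroup_iff']
  ext j k
  simp only [Matrix.star_eq_conjTranspose, Matrix.mul_apply, Matrix.conjTranspose_apply,
    Matrix.of_apply, RCLike.star_def, inner_conj_symm]
  rw [b₁.sum_inner_mul_inner, LinearIsometryEquiv.inner_map_map, TensorProduct.inner_tmul,
    inner_self_eq_norm_sq_to_K, ha, orthonormal_iff_ite.1 b₂.orthonormal, Matrix.one_apply]
  simp

theorem matrix_mul_matrix (E : G.Module r) {y₁ y₂ y₃ : Y} (h₁₂ : G.π y₁ = G.π y₂)
    (h₂₃ : G.π y₂ = G.π y₃)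
    {a : G.L.fiber ⟨(y₁, y₂), h₁₂⟩} {b : G.L.fiber ⟨(y₂, y₃), h₂₃⟩}
    {c : G.L.fiber ⟨(y₁, y₃), h₁₂.trans h₂₃⟩} {g : ℂ}
    (hg : G.mul _ _ _ h₁₂ h₂₃ (a ⊗ₜ b) = g • c)
    (b₁ : OrthonormalBasis (Fin r) ℂ (E.E.fiber y₁))
    (b₂ : OrthonormalBasis (Fin r) ℂ (E.E.fiber y₂))
    (b₃ : OrthonormalBasis (Fin r) ℂ (E.E.fiber y₃)) :
    Matrix.of (fun i j => (inner ℂ (b₁ i) (E.act _ _ h₁₂ (a ⊗ₜ b₂ j)) : ℂ)) *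
        Matrix.of (fun i j => (inner ℂ (b₂ i) (E.act _ _ h₂₃ (b ⊗ₜ b₃ j)) : ℂ)) =
      g • Matrix.of (fun i j => (inner ℂ (b₁ i) (E.act _ _ (h₁₂.trans h₂₃) (c ⊗ₜ b₃ j)) : ℂ)) := by
  ext i k
  have e := E.act_act _ _ _ h₁₂ h₂₃ a b (b₃ k)
  rw [hg, ← TensorProduct.smul_tmul', map_smul] at e
  simp only [Matrix.mul_apply, Matrix.of_apply, Matrix.smul_apply, smul_eq_mul]
  rw [← inner_smul_right, ← e]
  conv_rhs => rw [← b₂.sum_repr' (E.act _ _ h₂₃ (b ⊗ₜ b₃ k)), TensorProduct.tmul_sum, map_sum,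
    inner_sum]
  -- With the inner vector expanded in the middle basis `b₂`, the two sides match term by term.
  refine Finset.sum_congr rfl fun j _ => ?_
  rw [TensorProduct.tmul_smul, map_smul, inner_smul_right, mul_comm]

/-- The determinant argument: h_xy is the determinant of the action of `σ x y` in frames of `E`
along the local sections. -/
theorem nsmul_mem_cechCoboundaries [T2Space M] [ParacompactSpace M] (E : G.Module r)
    (D : G.DixmierDouadyData)
    {n : (Fin 4 → M) → M → ℤ}
    (hn : ∀ x, ∀ p ∈ D.cover.inter x, ((n x p : ℤ) : ℝ) = cechDelta 2 D.f x p) :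
    r • n ∈ cechCoboundaries M 3 := by
  choose e he hxe using fun x : M => E.E.exists_mem_dom (D.s x x)
  let 𝒰 : PointedCover M :=
    { U := fun x => D.cover.U x ∩ D.s x ⁻¹' (e x).dom
      isOpen_U := fun x => (D.smooth_s x).continuousOn.isOpen_inter_preimage (D.cover.isOpen_U x)
        (E.E.isOpen_dom _ (he x))
      mem_U := fun x => ⟨D.cover.mem_U x, hxe x⟩ }
  have hU : ∀ x, 𝒰.U x ⊆ D.cover.U x := fun x => Set.inter_subset_left
  have hs : ∀ {x y p}, p ∈ 𝒰.U x → p ∈ 𝒰.U y → G.π (D.s x p) = G.π (D.s y p) :=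
    fun h h' => (D.π_s _ _ h.1).trans (D.π_s _ _ h'.1).symm
  have hh : ∀ x y, ∃ H : M → ℂ, ContinuousOn H (𝒰.U x ∩ 𝒰.U y) ∧
      ∀ p (hx : p ∈ 𝒰.U x) (hy : p ∈ 𝒰.U y), H p =
        (Matrix.of fun i j => (inner ℂ ((e x).basis (D.s x p) i)
          (E.act _ _ (hs hx hy)
            (D.σ x y ⟨p, hx.1, hy.1⟩ ⊗ₜ (e y).basis (D.s y p) j)) : ℂ)).det := by
    intro x y
    let T := ↥(𝒰.U x ∩ 𝒰.U y)
    have hσ := (D.continuousSection_σ x y).comp (S := T)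
      (ψ := fun p => ⟨p, hU x p.2.1, hU y p.2.2⟩) (by fun_prop)
    have hA := fun i j => E.continuous_inner_act (D.continuous_s fun p (hp : p ∈ _) => hU x hp.1)
      (D.continuous_s fun p hp => hU y hp.2) (fun p : T => hs p.2.1 p.2.2) hσ (he x) (he y)
      (fun p => p.2.1.2) (fun p => p.2.2.2) i j
    have hdet : Continuous fun p : T =>
        (Matrix.of fun i j => (inner ℂ ((e x).basis (D.s x p) i) (E.act _ _ (hs p.2.1 p.2.2)
          (D.σ x y ⟨p, hU x p.2.1, hU y p.2.2⟩ ⊗ₜ (e y).basis (D.s y p) j)) : ℂ)).det :=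
      Continuous.matrix_det (continuous_matrix hA)
    obtain ⟨H, hH, hHp⟩ := exists_continuousOn_eq hdet
    exact ⟨H, hH, fun p hx hy => hHp ⟨p, hx, hy⟩⟩
  choose H hH hHp using hh
  have hinter : ∀ {m} (x : Fin (m + 1) → M), 𝒰.inter x ⊆ D.cover.inter x :=
    fun x => Set.iInter_mono fun k => hU _
  refine mem_cechCoboundaries_of_exp_eq 𝒰 (r • D.f)
    (fun x => ((D.continuousOn_f x).mono (hinter x)).const_smul r) _ (fun x p hp => ?_) H hH
    (fun x y p hp => ?_) (fun x y z p hx hy hz => ?_)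
  · rw [map_nsmul]
    simp [hn x p (hinter x hp)]
  · rw [hHp x y p hp.1 hp.2]
    exact CStarRing.norm_of_mem_unitary (Matrix.det_of_mem_unitary
      (E.unitary_of_norm_eq_one (hs hp.1 hp.2) (D.norm_σ x y ⟨p, hp.1.1, hp.2.1⟩)
        ((e x).basis (D.s x p)) ((e y).basis (D.s y p))))
  · have key := congrArg Matrix.det (E.matrix_mul_matrix (hs hx hy) (hs hy hz)
      (D.mul_σ x y z p hx.1 hy.1 hz.1) ((e x).basis (D.s x p)) ((e y).basis (D.s y p))
      ((e z).basis (D.s z p)))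
    -- The rank enters here: a scalar factor comes out of an r × r determinant to the power `r`.
    rw [Matrix.det_mul, Matrix.det_smul, Fintype.card_fin, ← Complex.exp_nat_mul] at key
    rw [hHp x y p hx hy, hHp y z p hy hz, hHp x z p hx hz, key]
    congr 2
    simp only [Pi.smul_apply, nsmul_eq_mul]
    push_cast
    ring

end Module

end BundleGerbe

/-- The first conjunct shows that the choice operator in `dixmierDouadyClass` picks out the unique
class that arises from any data, so the second conjunct is about the intended class. -/
theorem mainTheorem9 {EM HM EY HY : Type*}
    [NormedAddCommGroup EM] [NormedSpace ℝ EM] [TopologicalSpace HM]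
    [NormedAddCommGroup EY] [NormedSpace ℝ EY] [TopologicalSpace HY]
    (IM : ModelWithCorners ℝ EM HM) (IY : ModelWithCorners ℝ EY HY)
    (M Y : Type*)
    [TopologicalSpace M] [ChartedSpace HM M] [IsManifold IM ∞ M] [T2Space M] [ParacompactSpace M]
    [TopologicalSpace Y] [ChartedSpace HY Y] [IsManifold IY ∞ Y]
    (G : BundleGerbe IM IY M Y) (r : ℕ) (E : G.Module r) :
    (∀ c : CechCohomology M 3, G.IsDixmierDouadyClass c ↔ c = G.dixmierDouadyClass) ∧
      r • G.dixmierDouadyClass = 0 := by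
  refine ⟨BundleGerbe.isDixmierDouadyClass_iff, ?_⟩
  obtain ⟨D, n, hn, h⟩ := (BundleGerbe.isDixmierDouadyClass_iff G.dixmierDouadyClass).2 rfl
  rw [h]
  exact (QuotientAddGroup.eq_zero_iff (r • n)).2 (E.nsmul_mem_cechCoboundaries D hn)
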